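/- **Model.** Let $n\ge 2$, $q_{12},q_{21},\lambda_s>0$ and $\lambda>0$. A source $Q(t)\in\{1,2\}$ is a continuous-time Markov chain with transition rates $q_{12}$ ($1\to2$) and $q_{21}$ ($2\to1$) and stationary distribution $\pi_1=\frac{q_{21}}{q_{12}+q_{21}}$, $\pi_2=\frac{q_{12}}{q_{12}+q_{21}}$. Each node $i\in\{1,\dots,n\}$ stores a packet with content $S_i(t)\in\{1,2\}$ and version age $X_i(t)\in\{0,1,2,\dots\}$. The following events occur according to independent Poisson processes. At each source transition all version ages increase by $1$ and the contents stay. At rate $\lambda_s/n$ for each node $j$, the source pushes to $j$, which sets $S_j=Q$ and $X_j=0$. At rate $\frac{\lambda}{n-1}$ for each ordered pair $i\ne j$, node $i$ gossips to node $j$; if $X_i\le X_j$, then $j$ copies the packet of $i$ (content and age), and otherwise nothing changes. At time $0$ the system has any initial distribution for which, almost surely, packets of equal age have equal content and packets of age $0$ have content $Q(0)$. Put $C_i(t)=1$ if $S_i(t)=Q(t)$ and $C_i(t)=0$ otherwise. For a nonempty set $A$ of nodes let $C_A=\frac1{|A|}\sum_{i\in A}C_i$ be its average accuracy and $F_A=C_{\arg\min_{i\in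 A}X_i}$ the accuracy of its freshest node. **Claim.** Fix $q_{12},q_{21},\lambda_s>0$ and $n\ge2$, and put $\mu=\lambda_s/n$. For every $\lambda>0$, $m\in\{1,2\}$, $k\in\{1,\dots,n\}$ and every set $A$ of $k$ nodes, the limits $$f_k^{(m)}=\lim_{t\to\infty}\mathbb E\bigl[F_A(t)\mathbf 1_{\{Q(t)=m\}}\bigr],\qquad c^{(m)}=\lim_{t\to\infty}\mathbb E\bigl[C_A(t)\mathbf 1_{\{Q(t)=m\}}\bigr]$$ exist; they do not depend on the initial distribution, the first depends on $A$ only through $k$, and the second does not depend on $A$. With $\mathbf f_k=(f_k^{(1)},f_k^{(2)})^T$ and $f_k=f_k^{(1)}+f_k^{(2)}=\lim_{t\to\infty}\mathbb E[F_A(t)]$, the vector $\mathbf c=(c^{(1)},c^{(2)})^T$ is the unique solution of $$\begin{bmatrix}q_{12}+\mu+\lambda&q_{21}\\q_{12}&q_{21}+\mu+\lambda\end{bmatrix}\mathbf c=\begin{bmatrix}q_{21}\pi_2+\mu\pi_1\\q_{12}\pi_1+\mu\pi_2\end{bmatrix}+\lambda\,\mathbf f_2,$$ and $c=c^{(1)}+c^{(2)}=\lim_{t\to\infty}\mathbb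 E[C_A(t)]$ is the average accuracy. The vector $\mathbf f_n$ does not depend on $\lambda$ and equals $$\mathbf f_n=\frac{1}{(q_{12}+q_{21})(\lambda_s+q_{12}+q_{21})}\begin{bmatrix}q_{21}(\lambda_s+q_{21})\\q_{12}(\lambda_s+q_{12})\end{bmatrix}.$$ Moreover, as the gossip rate grows, $$\lim_{\lambda\to\infty}\mathbf c=\lim_{\lambda\to\infty}\mathbf f_2=\mathbf f_n,\qquad \lim_{\lambda\to\infty}c=f_n.$$ -/

import Mathlib

open MeasureTheory Filter Topology
open scoped BigOperators

noncomputable section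

namespace Gossip

/-- State of the system: the state of the two-state source (`0` and `1` stand for the states
`1` and `2`), the packet content stored at each node, and the version age of each node. -/
@[ext]
structure State (n : ℕ) where
  source : Fin 2
  content : Fin n → Fin 2
  age : Fin n → ℕ

instance (n : ℕ) : MeasurableSpace (State n) := ⊤

instance (n : ℕ) : DiscreteMeasurableSpace (State n) := ⟨fun _ => trivial⟩

/-- The events: a source transition `1 → 2`, a source transition `2 → 1`, a push from the source
to node `j`, a gossip message from node `i` to node `j`. -/
inductive Event (n : ℕ) where
  | up : Event n
  | down : Event n
  | push (j : Fin n) : Event n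
  | gossip (i j : Fin n) : Event n

instance (n : ℕ) : Fintype (Event n) :=
  Fintype.ofEquiv (Bool ⊕ Fin n ⊕ Fin n × Fin n)
    { toFun := fun s => match s with
        | .inl false => .up
        | .inl true => .down
        | .inr (.inl j) => .push j
        | .inr (.inr (i, j)) => .gossip i j
      invFun := fun e => match e with
        | .up => .inl false
        | .down => .inl true
        | .push j => .inr (.inl j)
        | .gossip i j => .inr (.inr (i, j))
      left_inv := by rintro ((_ | _) | (j | ⟨i, j⟩)) <;> rfl
      right_inv := by rintro (_ | _ | j | ⟨i, j⟩) <;> rfl }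

/-- The rate of the Poisson clock of each event. The clocks `up` and `down` act only while the
source is in state `1`, respectively `2` (see `fire`), and a node does not gossip to itself. -/
def clock (n : ℕ) (q₁₂ q₂₁ ls lam : ℝ) : Event n → ℝ
  | .up => q₁₂
  | .down => q₂₁
  | .push _ => ls / n
  | .gossip i j => if i = j then 0 else lam / (n - 1)

/-- The effect of each event. A source transition creates a new version, so that all version ages
grow by one while the stored contents stay. A push delivers the current source state with age `0`.
Under gossip, the receiver takes over the packet (content and age) of the sender if that packet is
at least as fresh as its own one. -/
def fire {n : ℕ} : Event n → State n → State n
  | .up, z => if z.source = 0 then ⟨1, z.content, fun l => z.age l + 1⟩ else z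
  | .down, z => if z.source = 1 then ⟨0, z.content, fun l => z.age l + 1⟩ else z
  | .push j, z =>
      ⟨z.source, Function.update z.content j z.source, Function.update z.age j 0⟩
  | .gossip i j, z =>
      if z.age i ≤ z.age j then
        ⟨z.source, Function.update z.content j (z.content i),
          Function.update z.age j (z.age i)⟩
      else z

/-- Total rate of all clocks. -/
def totalRate (n : ℕ) (q₁₂ q₂₁ ls lam : ℝ) : ℝ :=
  ∑ e : Event n, clock n q₁₂ q₂₁ ls lam e

/-- Law of the state after `k` rings of the clocks, starting from the law `ν`: every ring belongs,
independently of the past, to event `e` with probability proportional to the rate of `e`. -/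
def ringLaw {n : ℕ} (q₁₂ q₂₁ ls lam : ℝ) (ν : Measure (State n)) : ℕ → Measure (State n)
  | 0 => ν
  | k + 1 => ∑ e : Event n,
      ENNReal.ofReal (clock n q₁₂ q₂₁ ls lam e / totalRate n q₁₂ q₂₁ ls lam) •
        (ringLaw q₁₂ q₂₁ ls lam ν k).map (fire e)

/-- Law of the state of the gossip network at time `t ≥ 0`, starting from the law `ν`: the
superposition of the independent Poisson clocks has rung a Poisson distributed number of times. -/
def law {n : ℕ} (q₁₂ q₂₁ ls lam : ℝ) (ν : Measure (State n)) (t : ℝ) : Measure (State n) :=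
  Measure.sum fun k : ℕ =>
    ENNReal.ofReal (Real.exp (-(totalRate n q₁₂ q₂₁ ls lam * t)) *
      (totalRate n q₁₂ q₂₁ ls lam * t) ^ k / (k.factorial : ℝ)) •
        ringLaw q₁₂ q₂₁ ls lam ν k

section Generator

variable {n : ℕ} {q₁₂ q₂₁ ls lam : ℝ}

theorem clock_nonneg (hn : 2 ≤ n) (h12 : 0 < q₁₂) (h21 : 0 < q₂₁) (hs : 0 < ls) (hl : 0 < lam)
    (e : Event n) : 0 ≤ clock n q₁₂ q₂₁ ls lam e := by
  have h2 : (2 : ℝ) ≤ n := by exact_mod_cast hn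
  have h1 : (0 : ℝ) < (n : ℝ) - 1 := by linarith
  cases e <;> simp only [clock]
  · exact h12.le
  · exact h21.le
  · positivity
  · split_ifs
    · exact le_rfl
    · positivity

theorem totalRate_pos (hn : 2 ≤ n) (h12 : 0 < q₁₂) (h21 : 0 < q₂₁) (hs : 0 < ls) (hl : 0 < lam) :
    0 < totalRate n q₁₂ q₂₁ ls lam :=
  Finset.sum_pos' (fun e _ => clock_nonneg hn h12 h21 hs hl e) ⟨Event.up, Finset.mem_univ _, h12⟩

theorem isProbabilityMeasure_ringLaw (hn : 2 ≤ n) (h12 : 0 < q₁₂) (h21 : 0 < q₂₁) (hs : 0 < ls)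
    (hl : 0 < lam) (ν : Measure (State n)) [IsProbabilityMeasure ν] (k : ℕ) :
    IsProbabilityMeasure (ringLaw q₁₂ q₂₁ ls lam ν k) := by
  induction k with
  | zero => assumption
  | succ k ih =>
    have hpos := totalRate_pos hn h12 h21 hs hl
    refine ⟨?_⟩
    have hmap : ∀ e : Event n, ((ringLaw q₁₂ q₂₁ ls lam ν k).map (fire e)) Set.univ = 1 :=
      fun e => by rw [Measure.map_apply (Measurable.of_discrete) MeasurableSet.univ]; simp
    simp only [ringLaw, Measure.coe_finsetSum, Finset.sum_apply, Measure.smul_apply, hmap,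
      smul_eq_mul, mul_one]
    rw [← ENNReal.ofReal_sum_of_nonneg
      (fun e _ => div_nonneg (clock_nonneg hn h12 h21 hs hl e) hpos.le), ← Finset.sum_div]
    change ENNReal.ofReal (totalRate n q₁₂ q₂₁ ls lam / totalRate n q₁₂ q₂₁ ls lam) = 1
    rw [div_self hpos.ne', ENNReal.ofReal_one]

theorem isProbabilityMeasure_law (hn : 2 ≤ n) (h12 : 0 < q₁₂) (h21 : 0 < q₂₁) (hs : 0 < ls)
    (hl : 0 < lam) (ν : Measure (State n)) [IsProbabilityMeasure ν] {t : ℝ} (ht : 0 ≤ t) :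
    IsProbabilityMeasure (law q₁₂ q₂₁ ls lam ν t) := by
  have hpos := totalRate_pos hn h12 h21 hs hl
  have := isProbabilityMeasure_ringLaw hn h12 h21 hs hl ν
  refine ⟨?_⟩
  have hx : 0 ≤ totalRate n q₁₂ q₂₁ ls lam * t := by positivity
  simp only [law, Measure.sum_apply _ MeasurableSet.univ, Measure.smul_apply, measure_univ,
    smul_eq_mul, mul_one]
  have hsum := (NormedSpace.expSeries_div_hasSum_exp
    (totalRate n q₁₂ q₂₁ ls lam * t)).mul_left (Real.exp (-(totalRate n q₁₂ q₂₁ ls lam * t)))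
  rw [← Real.exp_eq_exp_ℝ, ← Real.exp_add, neg_add_cancel, Real.exp_zero] at hsum
  simp only [← mul_div_assoc] at hsum
  rw [← ENNReal.ofReal_tsum_of_nonneg (fun k => by positivity) hsum.summable, hsum.tsum_eq,
    ENNReal.ofReal_one]

theorem law_zero (ν : Measure (State n)) : law q₁₂ q₂₁ ls lam ν 0 = ν := by
  ext s hs
  rw [law, Measure.sum_apply _ hs, tsum_eq_single 0]
  · simp [ringLaw]
  · intro k hk
    simp [hk]

theorem integral_ringLaw_succ (hn : 2 ≤ n) (h12 : 0 < q₁₂) (h21 : 0 < q₂₁) (hs : 0 < ls)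
    (hl : 0 < lam) (ν : Measure (State n)) [IsProbabilityMeasure ν] {ψ : State n → ℝ} {B : ℝ}
    (hψ : ∀ z, |ψ z| ≤ B) (k : ℕ) :
    totalRate n q₁₂ q₂₁ ls lam * ∫ z, ψ z ∂(ringLaw q₁₂ q₂₁ ls lam ν (k + 1)) =
      ∑ e, clock n q₁₂ q₂₁ ls lam e * ∫ z, ψ (fire e z) ∂(ringLaw q₁₂ q₂₁ ls lam ν k) := by
  have hpos := totalRate_pos hn h12 h21 hs hl
  have := isProbabilityMeasure_ringLaw hn h12 h21 hs hl ν
  have hψint : ∀ (μ : Measure (State n)) [IsFiniteMeasure μ], Integrable ψ μ := fun μ _ =>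
    Integrable.of_bound (Measurable.of_discrete).aestronglyMeasurable B
      (ae_of_all _ fun z => by simpa using hψ z)
  rw [ringLaw, integral_finsetSum_measure, Finset.mul_sum]
  · refine Finset.sum_congr rfl fun e _ => ?_
    rw [integral_smul_measure, integral_map (Measurable.of_discrete).aemeasurable
      (Measurable.of_discrete).aestronglyMeasurable, ENNReal.toReal_ofReal
      (div_nonneg (clock_nonneg hn h12 h21 hs hl e) hpos.le), smul_eq_mul]
    field_simp
  · intro e _
    have : IsFiniteMeasure ((ringLaw q₁₂ q₂₁ ls lam ν k).map (fire e)) := inferInstance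
    exact (hψint _).smul_measure ENNReal.ofReal_ne_top

theorem hasSum_integral_law (hn : 2 ≤ n) (h12 : 0 < q₁₂) (h21 : 0 < q₂₁) (hs : 0 < ls)
    (hl : 0 < lam) (ν : Measure (State n)) [IsProbabilityMeasure ν] {ψ : State n → ℝ} {B : ℝ}
    (hψ : ∀ z, |ψ z| ≤ B) {t : ℝ} (ht : 0 ≤ t) :
    HasSum (fun k : ℕ => Real.exp (-(totalRate n q₁₂ q₂₁ ls lam * t)) *
      (totalRate n q₁₂ q₂₁ ls lam * t) ^ k / (k.factorial : ℝ) *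
        ∫ z, ψ z ∂(ringLaw q₁₂ q₂₁ ls lam ν k)) (∫ z, ψ z ∂(law q₁₂ q₂₁ ls lam ν t)) := by
  have hpos := totalRate_pos hn h12 h21 hs hl
  have := isProbabilityMeasure_law hn h12 h21 hs hl ν ht
  have hψint : Integrable ψ (law q₁₂ q₂₁ ls lam ν t) :=
    Integrable.of_bound (Measurable.of_discrete).aestronglyMeasurable B
      (ae_of_all _ fun z => by simpa using hψ z)
  have h := hasSum_integral_measure (μ := fun k : ℕ =>
    ENNReal.ofReal (Real.exp (-(totalRate n q₁₂ q₂₁ ls lam * t)) *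
      (totalRate n q₁₂ q₂₁ ls lam * t) ^ k / (k.factorial : ℝ)) •
        ringLaw q₁₂ q₂₁ ls lam ν k) hψint
  convert! h using 2 with k
  rw [integral_smul_measure, ENNReal.toReal_ofReal (by positivity), smul_eq_mul]

theorem hasDerivAt_tsum_bounded {a : ℕ → ℝ} {B : ℝ} (ha : ∀ k, |a k| ≤ B) (x : ℝ) :
    HasDerivAt (fun x : ℝ => ∑' k : ℕ, x ^ k / (k.factorial : ℝ) * a k)
      (∑' k : ℕ, x ^ k / (k.factorial : ℝ) * a (k + 1)) x := by
  have hB : 0 ≤ B := (abs_nonneg _).trans (ha 0)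
  set R : ℝ := |x| + 1
  have hR : 0 < R := by positivity
  have hsum : Summable fun k : ℕ => R ^ k / (k.factorial : ℝ) := Real.summable_pow_div_factorial R
  have hd : ∀ (k : ℕ) (y : ℝ), HasDerivAt (fun y : ℝ => y ^ k / (k.factorial : ℝ) * a k)
      ((k : ℝ) * y ^ (k - 1) / (k.factorial : ℝ) * a k) y := fun k y =>
    ((hasDerivAt_pow k y).div_const _).mul_const _
  have hu : Summable fun k : ℕ => (k : ℝ) * R ^ (k - 1) / (k.factorial : ℝ) * B := by
    rw [← summable_nat_add_iff 1]
    refine (hsum.mul_right B).congr fun k => ?_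
    rw [Nat.factorial_succ]; push_cast
    field_simp
  have key := hasDerivAt_tsum_of_isPreconnected hu (Metric.isOpen_ball (x := (0 : ℝ)) (ε := R))
    (convex_ball (0 : ℝ) R).isPreconnected (fun k y _ => hd k y) (y₀ := 0) (y := x) ?_
    (Metric.mem_ball_self hR) ?_ (by simp [R])
  · convert! key using 1
    have hs' : Summable fun k : ℕ => (k : ℝ) * x ^ (k - 1) / (k.factorial : ℝ) * a k := by
      refine Summable.of_norm_bounded hu fun k => ?_
      rw [norm_mul, norm_div, norm_mul, norm_pow, Real.norm_natCast, Real.norm_natCast]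
      gcongr
      · simp [R]
      · exact ha k
    rw [hs'.tsum_eq_zero_add]
    simp only [Nat.cast_zero, zero_mul, zero_div, zero_add, Nat.add_sub_cancel]
    refine tsum_congr fun k => ?_
    rw [Nat.factorial_succ]; push_cast
    field_simp
  · intro k y hy
    rw [norm_mul, norm_div, norm_mul, norm_pow, Real.norm_natCast, Real.norm_natCast]
    gcongr
    · exact (mem_ball_zero_iff.mp hy).le
    · exact ha k
  · refine summable_of_ne_finset_zero (s := {0}) fun k hk => ?_
    have : k ≠ 0 := by simpa using hk
    simp [this]

/-- Dynkin's formula: `law` is the law of the Markov jump process with the generator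
`ψ ↦ ∑ e, clock e * (ψ ∘ fire e - ψ)`. Together with `law_zero` this determines `law`, as the
generator is bounded. -/
theorem hasDerivAt_integral_law (hn : 2 ≤ n) (h12 : 0 < q₁₂) (h21 : 0 < q₂₁) (hs : 0 < ls)
    (hl : 0 < lam) (ν : Measure (State n)) [IsProbabilityMeasure ν] {ψ : State n → ℝ} {B : ℝ}
    (hψ : ∀ z, |ψ z| ≤ B) {t : ℝ} (ht : 0 < t) :
    HasDerivAt (fun t => ∫ z, ψ z ∂(law q₁₂ q₂₁ ls lam ν t))
      (∫ z, ∑ e, clock n q₁₂ q₂₁ ls lam e * (ψ (fire e z) - ψ z)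
        ∂(law q₁₂ q₂₁ ls lam ν t)) t := by
  have hpos := totalRate_pos hn h12 h21 hs hl
  have hring := isProbabilityMeasure_ringLaw hn h12 h21 hs hl ν
  have hlaw := isProbabilityMeasure_law hn h12 h21 hs hl ν ht.le
  have hψint : ∀ (φ : State n → ℝ), (∀ z, |φ z| ≤ B) → ∀ (μ : Measure (State n))
      [IsFiniteMeasure μ], Integrable φ μ := fun φ hφ μ _ =>
    Integrable.of_bound (Measurable.of_discrete).aestronglyMeasurable B
      (ae_of_all _ fun z => by simpa using hφ z)
  set L := totalRate n q₁₂ q₂₁ ls lam with hL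
  set a : ℕ → ℝ := fun k => ∫ z, ψ z ∂(ringLaw q₁₂ q₂₁ ls lam ν k) with ha
  have hab : ∀ k, |a k| ≤ B := fun k => by
    have := norm_integral_le_of_norm_le_const (μ := ringLaw q₁₂ q₂₁ ls lam ν k)
      (ae_of_all _ fun z => (by simpa using hψ z : ‖ψ z‖ ≤ B))
    simpa using this
  have hE : ∀ {φ : State n → ℝ}, (∀ z, |φ z| ≤ B) → ∀ {t : ℝ}, 0 ≤ t →
      HasSum (fun k : ℕ => Real.exp (-(L * t)) * ((L * t) ^ k / (k.factorial : ℝ) *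
        ∫ z, φ z ∂(ringLaw q₁₂ q₂₁ ls lam ν k))) (∫ z, φ z ∂(law q₁₂ q₂₁ ls lam ν t)) := by
    intro φ hφ t ht
    convert! hasSum_integral_law hn h12 h21 hs hl ν hφ ht using 2
    ring
  have hev : (fun t => ∫ z, ψ z ∂(law q₁₂ q₂₁ ls lam ν t)) =ᶠ[𝓝 t] fun t =>
      Real.exp (-(L * t)) * ∑' k : ℕ, (L * t) ^ k / (k.factorial : ℝ) * a k := by
    filter_upwards [lt_mem_nhds ht] with t ht
    rw [← tsum_mul_left]
    exact (hE hψ ht.le).tsum_eq.symm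
  refine HasDerivAt.congr_of_eventuallyEq ?_ hev
  have hlin : HasDerivAt (fun t : ℝ => L * t) L t := by
    simpa using (hasDerivAt_id t).const_mul L
  have hder := (hlin.neg.exp).mul ((hasDerivAt_tsum_bounded hab (L * t)).comp t hlin)
  convert! hder using 1
  simp only [Finset.sum_sub_distrib, mul_sub]
  have hI : ∀ e : Event n, Integrable (fun z => clock n q₁₂ q₂₁ ls lam e * ψ (fire e z))
      (law q₁₂ q₂₁ ls lam ν t) := fun e => (hψint _ (fun z => hψ _) _).const_mul _
  rw [integral_sub (integrable_finsetSum _ fun e _ => hI e)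
    (integrable_finsetSum _ fun e _ => (hψint _ hψ _).const_mul _),
    integral_finsetSum _ (fun e _ => hI e)]
  simp only [integral_const_mul, ← Finset.sum_mul]
  change _ - L * _ = _
  have h1 : HasSum (fun k : ℕ => ∑ e, clock n q₁₂ q₂₁ ls lam e * (Real.exp (-(L * t)) *
      ((L * t) ^ k / (k.factorial : ℝ) * ∫ z, ψ (fire e z) ∂(ringLaw q₁₂ q₂₁ ls lam ν k))))
      (∑ e, clock n q₁₂ q₂₁ ls lam e * ∫ z, ψ (fire e z) ∂(law q₁₂ q₂₁ ls lam ν t)) :=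
    hasSum_sum fun e _ => (hE (φ := fun z => ψ (fire e z)) (fun z => hψ _) ht.le).mul_left _
  rw [← h1.tsum_eq, ← (hE hψ ht.le).tsum_eq]
  have h2 : ∀ k : ℕ, (∑ e, clock n q₁₂ q₂₁ ls lam e * (Real.exp (-(L * t)) *
      ((L * t) ^ k / (k.factorial : ℝ) * ∫ z, ψ (fire e z) ∂(ringLaw q₁₂ q₂₁ ls lam ν k)))) =
      (Real.exp (-(L * t)) * L) * ((L * t) ^ k / (k.factorial : ℝ) * a (k + 1)) := by
    intro k
    have := integral_ringLaw_succ hn h12 h21 hs hl ν hψ k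
    simp only [ha, hL]
    rw [mul_assoc (Real.exp _), ← mul_assoc (totalRate n q₁₂ q₂₁ ls lam), mul_comm
      (totalRate n q₁₂ q₂₁ ls lam) (_ / _), mul_assoc (_ / _), this, Finset.mul_sum,
      Finset.mul_sum]
    exact Finset.sum_congr rfl fun e _ => by ring
  simp only [h2, tsum_mul_left, Function.comp, Pi.neg_apply]
  ring

end Generator

/-- `C_l`: whether the content of node `l` is the current state of the source. -/
def acc {n : ℕ} (z : State n) (l : Fin n) : ℝ :=
  if z.content l = z.source then 1 else 0

/-- `C_A`: the fraction of accurate nodes in `A`. -/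
def avgAcc {n : ℕ} (A : Finset (Fin n)) (z : State n) : ℝ :=
  (∑ l ∈ A, acc z l) / (A.card : ℝ)

/-- `F_A`: the accuracy of the freshest node of `A` (only used for nonempty `A`). -/
def freshAcc {n : ℕ} (A : Finset (Fin n)) (z : State n) : ℝ :=
  if hA : A.Nonempty then
    acc z (Function.argminOn z.age (A : Set (Fin n)) (Finset.coe_nonempty.mpr hA))
  else 0

/-- Every version has one content: packets of the same version have the same content, and the
current version carries the current source state. -/
def Consistent {n : ℕ} (z : State n) : Prop :=
  (∀ i j, z.age i = z.age j → z.content i = z.content j) ∧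
    ∀ i, z.age i = 0 → z.content i = z.source

/-- The indicator of the event that the source is in mode `m`. -/
def inMode {n : ℕ} (m : Fin 2) (z : State n) : ℝ := if z.source = m then 1 else 0

/-- Stationary distribution of the source. -/
def statDist (q₁₂ q₂₁ : ℝ) : Fin 2 → ℝ :=
  ![q₂₁ / (q₁₂ + q₂₁), q₁₂ / (q₁₂ + q₂₁)]

/-- Coefficient matrix of the linear system of the average accuracy; `μ = ls / n`. -/
def accMatrix (n : ℕ) (q₁₂ q₂₁ ls lam : ℝ) : Matrix (Fin 2) (Fin 2) ℝ :=
  !![q₁₂ + ls / n + lam, q₂₁; q₁₂, q₂₁ + ls / n + lam]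

/-- Constant vector of the linear system of the average accuracy; `μ = ls / n`. -/
def accVector (n : ℕ) (q₁₂ q₂₁ ls : ℝ) : Fin 2 → ℝ :=
  ![q₂₁ * statDist q₁₂ q₂₁ 1 + ls / n * statDist q₁₂ q₂₁ 0,
    q₁₂ * statDist q₁₂ q₂₁ 0 + ls / n * statDist q₁₂ q₂₁ 1]

/-- The closed form of the mode-tagged accuracy of the freshest node of the whole network. -/
def fullFreshness (q₁₂ q₂₁ ls : ℝ) : Fin 2 → ℝ :=
  ![q₂₁ * (ls + q₂₁) / ((q₁₂ + q₂₁) * (ls + q₁₂ + q₂₁)),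
    q₁₂ * (ls + q₁₂) / ((q₁₂ + q₂₁) * (ls + q₁₂ + q₂₁))]

end Gossip

end

noncomputable section

namespace Gossip

/-! ### Effect of single events on the freshest packet -/

section Dynamics

variable {n : ℕ} {z : State n} {A : Finset (Fin n)}

/-! For a fixed set `A`, the observables F_A 1{Q = m} lead to a hierarchy that closes upwards in
`A`. A source transition shifts all ages alike, so the freshest node stays the freshest, and with
only two source states its accuracy F_A turns into 1 - F_A. A push into `A` makes F_A equal to 1. A
message from `i` to a node of `A` replaces F_A by the value for `A ∪ {i}`. These rules hold on
consistent states, which every event preserves (`freshAcc_push`, `freshAcc_gossip`,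
`freshAcc_of_source_ne`).

By Dynkin's formula the two expectations for `A` then solve x' = b(t) - M x, where M has rows (p +
r, q) and (p, q + r). The forcing b contains only mode probabilities and expectations for sets with
one more node. The row vectors (1, -1) and (p, q) are left eigenvectors of M with eigenvalues r and
p + q + r, so x converges whenever b does (`tendsto_balanceSol`). Induction on the number of missing
nodes starts from the whole network, where gossip has no effect, and yields limits depending only on
the size of `A` (`tendsto_integral_freshAcc`). The average accuracy is the case of singletons.

For large gossip rates, the gossip terms dominate both M and b at each level below the top, so each
limit approaches that of the next larger size, and all of them approach the value for the whole
network (`tendsto_coFresh`). -/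

theorem Consistent.fire (hz : Consistent z) (e : Event n) : Consistent (fire e z) := by
  obtain ⟨h1, h2⟩ := hz
  cases e with
  | up =>
    simp only [Gossip.fire]
    split_ifs
    · exact ⟨fun i j h => h1 i j (by simpa using h), fun i h => by simp at h⟩
    · exact ⟨h1, h2⟩
  | down =>
    simp only [Gossip.fire]
    split_ifs
    · exact ⟨fun i j h => h1 i j (by simpa using h), fun i h => by simp at h⟩
    · exact ⟨h1, h2⟩
  | push j =>
    refine ⟨fun a b h => ?_, fun a h => ?_⟩ <;> simp only [Gossip.fire, Function.update_apply] at h ⊢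
    · split_ifs at h ⊢
      · rfl
      · exact (h2 b h.symm).symm
      · exact h2 a h
      · exact h1 a b h
    · split_ifs at h ⊢
      · rfl
      · exact h2 a h
  | gossip i j =>
    simp only [Gossip.fire]
    split_ifs
    · refine ⟨fun a b h => ?_, fun a h => ?_⟩ <;> simp only [Function.update_apply] at h ⊢
      · split_ifs at h ⊢
        · rfl
        · exact h1 _ _ h
        · exact h1 _ _ h
        · exact h1 _ _ h
      · split_ifs at h ⊢
        · exact h2 _ h
        · exact h2 _ h
    · exact ⟨h1, h2⟩

/-- Consistency makes tie-breaking irrelevant: two minimizers of the age hold the same content, so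
any convenient one may stand in for `argminOn`. -/
theorem freshAcc_eq_acc (hz : Consistent z) {i : Fin n} (hi : i ∈ A)
    (hmin : ∀ j ∈ A, z.age i ≤ z.age j) : freshAcc A z = acc z i := by
  have hA : A.Nonempty := ⟨i, hi⟩
  rw [freshAcc, dif_pos hA]
  have hm := Function.argminOn_mem z.age (A : Set (Fin n)) (Finset.coe_nonempty.mpr hA)
  have hle := Function.argminOn_le z.age (A : Set (Fin n)) (a := i) hi
  unfold acc
  rw [hz.1 _ i (le_antisymm hle (hmin _ hm))]

theorem freshAcc_singleton (z : State n) (l : Fin n) : freshAcc {l} z = acc z l := by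
  have h := Function.argminOn_mem z.age (({l} : Finset (Fin n)) : Set (Fin n)) (by simp)
  rw [freshAcc, dif_pos (Finset.singleton_nonempty l)]
  congr 1
  exact Finset.mem_singleton.mp (Finset.mem_coe.mp h)

theorem abs_acc_le (z : State n) (l : Fin n) : |acc z l| ≤ 1 := by
  unfold acc
  split_ifs <;> simp

theorem abs_freshAcc_le (A : Finset (Fin n)) (z : State n) : |freshAcc A z| ≤ 1 := by
  unfold freshAcc
  split_ifs
  · exact abs_acc_le _ _
  · simp

theorem abs_inMode_le (m : Fin 2) (z : State n) : |inMode m z| ≤ 1 := by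
  unfold inMode
  split_ifs <;> simp

theorem abs_freshAcc_mul_inMode_le (A : Finset (Fin n)) (m : Fin 2) (z : State n) :
    |freshAcc A z * inMode m z| ≤ 1 := by
  rw [abs_mul]
  exact mul_le_one₀ (abs_freshAcc_le A z) (abs_nonneg _) (abs_inMode_le m z)

theorem freshAcc_push (hz : Consistent z) (hA : A.Nonempty) (j : Fin n) :
    freshAcc A (fire (.push j) z) = if j ∈ A then 1 else freshAcc A z := by
  split_ifs with hj
  · rw [freshAcc_eq_acc (hz.fire _) hj (fun l _ => by simp [fire])]
    simp [acc, fire]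
  · obtain ⟨a, ha, hmin⟩ := A.exists_min_image z.age hA
    have hne : ∀ l ∈ A, l ≠ j := fun l hl h => hj (h ▸ hl)
    rw [freshAcc_eq_acc hz ha hmin, freshAcc_eq_acc (hz.fire _) ha]
    · simp [acc, fire, hne a ha]
    · intro l hl
      simpa [fire, hne a ha, hne l hl] using hmin l hl

/-- The packet overwritten at `j` is no fresher than the one received, so for `j ∈ A` the freshest
packet in `A` afterwards is the freshest one in `insert i A` before. -/
theorem freshAcc_gossip (hz : Consistent z) (hA : A.Nonempty) (i j : Fin n) :
    freshAcc A (fire (.gossip i j) z) =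
      if j ∈ A then freshAcc (insert i A) z else freshAcc A z := by
  have hz' := hz.fire (.gossip i j)
  obtain ⟨a, ha, hmin⟩ := A.exists_min_image z.age hA
  by_cases hij : z.age i ≤ z.age j
  · simp only [fire, hij, if_true] at hz' ⊢
    split_ifs with hj
    · by_cases hi : ∀ l ∈ A, z.age i ≤ z.age l
      · rw [freshAcc_eq_acc hz (Finset.mem_insert_self i A) (by simpa using hi),
          freshAcc_eq_acc hz' hj]
        · simp [acc]
        · intro l hl
          by_cases hlj : l = j
          · simp [hlj]
          · simpa [hlj] using hi l hl
      -- Some node of `A` beats `i`, hence so does the freshest node `a`. As `j` is no fresher than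
      -- `i`, `a ≠ j` and its packet survives.
      · push Not at hi
        obtain ⟨l, hl, hli⟩ := hi
        have hai : z.age a < z.age i := (hmin l hl).trans_lt hli
        have haj : a ≠ j := by rintro rfl; omega
        rw [freshAcc_eq_acc hz (Finset.mem_insert_of_mem ha)
          (by simpa using ⟨hai.le, hmin⟩), freshAcc_eq_acc hz' ha]
        · simp [acc, haj]
        · intro l hl
          by_cases hlj : l = j
          · simpa [hlj, haj] using hai.le
          · simpa [hlj, haj] using hmin l hl
    · have hne : ∀ l ∈ A, l ≠ j := fun l hl h => hj (h ▸ hl)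
      rw [freshAcc_eq_acc hz ha hmin, freshAcc_eq_acc hz' ha]
      · simp [acc, hne a ha]
      · intro l hl
        simpa [hne a ha, hne l hl] using hmin l hl
  -- The message is rejected: `j` is strictly fresher than `i`, so adding `i` to a set containing
  -- `j` does not change its freshest packet.
  · simp only [fire, hij, if_false]
    split_ifs with hj
    · have hai : z.age a ≤ z.age i := (hmin j hj).trans (not_le.mp hij).le
      rw [freshAcc_eq_acc hz ha hmin, freshAcc_eq_acc hz (Finset.mem_insert_of_mem ha)
        (by simpa using ⟨hai, hmin⟩)]
    · rfl

theorem inMode_push (m : Fin 2) (j : Fin n) (z : State n) :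
    inMode m (fire (.push j) z) = inMode m z := rfl

theorem inMode_gossip (m : Fin 2) (i j : Fin n) (z : State n) :
    inMode m (fire (.gossip i j) z) = inMode m z := by
  simp only [fire]
  split_ifs <;> rfl

theorem freshAcc_of_source_ne {z' : State n} (hz : Consistent z) (hz' : Consistent z')
    (hA : A.Nonempty) (hc : z'.content = z.content) (ha : ∀ l, z'.age l = z.age l + 1)
    (hs : z'.source ≠ z.source) : freshAcc A z' = 1 - freshAcc A z := by
  obtain ⟨a, haA, hmin⟩ := A.exists_min_image z.age hA
  rw [freshAcc_eq_acc hz haA hmin, freshAcc_eq_acc hz' haA (by simpa [ha] using hmin), acc, acc, hc]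
  by_cases h : z.content a = z.source
  · have : ¬ z.content a = z'.source := fun h' => hs (h' ▸ h)
    simp [h, hs.symm]
  · have : z.content a = z'.source := by omega
    simp [this, hs]

theorem sum_event (g : Event n → ℝ) :
    ∑ e, g e = g .up + g .down + ∑ j, g (.push j) + ∑ i, ∑ j, g (.gossip i j) := by
  have hinj : Function.Bijective (fun s : Bool ⊕ Fin n ⊕ Fin n × Fin n => match s with
      | .inl false => (.up : Event n)
      | .inl true => .down
      | .inr (.inl j) => .push j
      | .inr (.inr (i, j)) => .gossip i j) := by
    constructor
    · rintro ((_ | _) | (j | ⟨i, j⟩)) ((_ | _) | (j' | ⟨i', j'⟩)) h <;> simp_all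
    · rintro (_ | _ | j | ⟨i, j⟩)
      · exact ⟨.inl false, rfl⟩
      · exact ⟨.inl true, rfl⟩
      · exact ⟨.inr (.inl j), rfl⟩
      · exact ⟨.inr (.inr (i, j)), rfl⟩
  rw [← hinj.sum_comp g]
  simp only [Fintype.sum_sum_type, Fintype.sum_bool, Fintype.sum_prod_type]
  ring

end Dynamics

/-! ### The generator on mode-tagged accuracies -/

section Generator

variable {n : ℕ} {q₁₂ q₂₁ ls lam : ℝ} {z : State n} {A : Finset (Fin n)}

theorem generator_inMode (z : State n) (m : Fin 2) :
    ∑ e, clock n q₁₂ q₂₁ ls lam e * (inMode m (fire e z) - inMode m z) =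
      ![q₂₁ * inMode 1 z - q₁₂ * inMode 0 z, q₁₂ * inMode 0 z - q₂₁ * inMode 1 z] m := by
  rw [sum_event]
  simp only [inMode_push, inMode_gossip, sub_self, mul_zero, Finset.sum_const_zero, add_zero]
  obtain h | h : z.source = 0 ∨ z.source = 1 := by omega
  all_goals fin_cases m <;> simp [clock, fire, inMode, h]

/-- Accuracy in one mode is fed by inaccuracy in the other, since a transition exchanges right and
wrong. The factor `A.card` in the last two terms counts the possible receivers in `A`. -/
theorem generator_freshAcc (hz : Consistent z) (hA : A.Nonempty) (m : Fin 2) :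
    ∑ e, clock n q₁₂ q₂₁ ls lam e *
        (freshAcc A (fire e z) * inMode m (fire e z) - freshAcc A z * inMode m z) =
      ![q₂₁ * (inMode 1 z - freshAcc A z * inMode 1 z) - q₁₂ * (freshAcc A z * inMode 0 z),
        q₁₂ * (inMode 0 z - freshAcc A z * inMode 0 z) - q₂₁ * (freshAcc A z * inMode 1 z)] m +
      A.card * (ls / n) * (inMode m z - freshAcc A z * inMode m z) +
      A.card * (lam / (n - 1)) *
        ∑ i ∈ Aᶜ, (freshAcc (insert i A) z * inMode m z - freshAcc A z * inMode m z) := by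
  have hpush : ∑ j, clock n q₁₂ q₂₁ ls lam (.push j) * (freshAcc A (fire (.push j) z) *
      inMode m (fire (.push j) z) - freshAcc A z * inMode m z) =
      A.card * (ls / n) * (inMode m z - freshAcc A z * inMode m z) := by
    have : ∀ j, clock n q₁₂ q₂₁ ls lam (.push j) * (freshAcc A (fire (.push j) z) *
        inMode m (fire (.push j) z) - freshAcc A z * inMode m z) =
        if j ∈ A then (ls / n) * (inMode m z - freshAcc A z * inMode m z) else 0 := by
      intro j
      rw [freshAcc_push hz hA, inMode_push]
      split_ifs <;> simp [clock]
    simp only [this, Finset.sum_ite_mem, Finset.univ_inter, Finset.sum_const, nsmul_eq_mul]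
    ring
  have hgossip : ∑ i, ∑ j, clock n q₁₂ q₂₁ ls lam (.gossip i j) *
      (freshAcc A (fire (.gossip i j) z) * inMode m (fire (.gossip i j) z) -
        freshAcc A z * inMode m z) = A.card * (lam / (n - 1)) *
        ∑ i ∈ Aᶜ, (freshAcc (insert i A) z * inMode m z - freshAcc A z * inMode m z) := by
    have : ∀ i j, clock n q₁₂ q₂₁ ls lam (.gossip i j) * (freshAcc A (fire (.gossip i j) z) *
        inMode m (fire (.gossip i j) z) - freshAcc A z * inMode m z) =
        if j ∈ A then (lam / (n - 1)) *
          (freshAcc (insert i A) z * inMode m z - freshAcc A z * inMode m z) else 0 := by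
      intro i j
      rw [freshAcc_gossip hz hA, inMode_gossip]
      split_ifs with hj
      -- On the diagonal the clock is zero, and the right side vanishes too because `insert i A =
      -- A`.
      · by_cases hij : i = j
        · subst hij
          simp [Finset.insert_eq_of_mem hj]
        · simp [clock, hij]
      · simp
    simp only [this, Finset.sum_ite_mem, Finset.univ_inter, Finset.sum_const, nsmul_eq_mul]
    rw [Finset.mul_sum, ← Finset.sum_subset (Finset.subset_univ Aᶜ)]
    · exact Finset.sum_congr rfl fun i _ => by ring
    · intro i _ hi
      rw [Finset.insert_eq_of_mem (by simpa using hi)]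
      simp
  rw [sum_event, hpush, hgossip]
  congr 2
  obtain h | h : z.source = 0 ∨ z.source = 1 := by omega
  · have hup : freshAcc A (fire .up z) = 1 - freshAcc A z :=
      freshAcc_of_source_ne hz (hz.fire _) hA (by simp [fire, h]) (by simp [fire, h])
        (by simp [fire, h])
    rw [hup]
    fin_cases m <;> simp [clock, fire, inMode, h]
  · have hdown : freshAcc A (fire .down z) = 1 - freshAcc A z :=
      freshAcc_of_source_ne hz (hz.fire _) hA (by simp [fire, h]) (by simp [fire, h])
        (by simp [fire, h])
    rw [hdown]
    fin_cases m <;> simp [clock, fire, inMode, h]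

theorem ae_consistent_ringLaw {ν : Measure (State n)} (hν : ∀ᵐ z ∂ν, Consistent z) (k : ℕ) :
    ∀ᵐ z ∂(ringLaw q₁₂ q₂₁ ls lam ν k), Consistent z := by
  induction k with
  | zero => exact hν
  | succ k ih =>
    rw [ringLaw, ae_iff, Measure.coe_finsetSum, Finset.sum_apply]
    refine Finset.sum_eq_zero fun e _ => ?_
    rw [Measure.smul_apply, Measure.map_apply Measurable.of_discrete .of_discrete]
    have : ∀ᵐ z ∂(ringLaw q₁₂ q₂₁ ls lam ν k), Consistent (fire e z) := ih.mono fun _ hz => hz.fire e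
    exact mul_eq_zero_of_right _ (ae_iff.mp this)

theorem ae_consistent_law {ν : Measure (State n)} (hν : ∀ᵐ z ∂ν, Consistent z) (t : ℝ) :
    ∀ᵐ z ∂(law q₁₂ q₂₁ ls lam ν t), Consistent z := by
  rw [law, Measure.ae_sum_iff' .of_discrete]
  exact fun k => Measure.ae_smul_measure (ae_consistent_ringLaw hν k) _

end Generator

/-! ### Linear relaxation equations and their limits -/

section Relaxation

/-- A solution of `y' = g - a y` with `a > 0` and `g → L` converges to `L / a`. -/
theorem tendsto_of_hasDerivAt_sub_mul {y g : ℝ → ℝ} {a L : ℝ} (ha : 0 < a)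
    (hy : ∀ t, 0 < t → HasDerivAt y (g t - a * y t) t) (hg : Tendsto g atTop (𝓝 L)) :
    Tendsto y atTop (𝓝 (L / a)) := by
  -- Only the upper bound is proved directly, for arbitrary `y`, `g`, `L`; the lower one follows by
  -- applying it to `-y`, `-g`, `-L`.
  have upper : ∀ (y g : ℝ → ℝ) (L : ℝ), (∀ t, 0 < t → HasDerivAt y (g t - a * y t) t) →
      Tendsto g atTop (𝓝 L) → ∀ b, L / a < b → ∀ᶠ t in atTop, y t < b := by
    intro y g L hy hg b hb
    -- Eventually `g < a * c`, so `exp (a t) (y - c)` is nonincreasing; the gap between `c` and `b`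
    -- absorbs the exponentially small remainder.
    obtain ⟨c, hLc, hcb⟩ := exists_between hb
    have hev : ∀ᶠ t in atTop, g t < a * c :=
      hg.eventually_lt_const (by rwa [div_lt_iff₀' ha] at hLc)
    obtain ⟨T, hT⟩ := eventually_atTop.mp (hev.and (eventually_gt_atTop 0))
    have hder : ∀ t, T ≤ t → HasDerivAt (fun t => Real.exp (a * t) * (y t - c))
        (Real.exp (a * t) * (g t - a * c)) t := by
      intro t ht
      have h1 : HasDerivAt (fun t : ℝ => a * t) a t := by
        simpa using (hasDerivAt_id t).const_mul a
      convert! h1.exp.mul ((hy t (hT t ht).2).sub_const c) using 1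
      ring
    have hanti : AntitoneOn (fun t => Real.exp (a * t) * (y t - c)) (Set.Ici T) := by
      refine antitoneOn_of_deriv_nonpos (convex_Ici T)
        (fun t ht => (hder t ht).continuousAt.continuousWithinAt)
        (fun t ht => ?_) (fun t ht => ?_)
      · exact (hder t (interior_subset ht)).differentiableAt.differentiableWithinAt
      · rw [(hder t (interior_subset ht)).deriv]
        exact mul_nonpos_of_nonneg_of_nonpos (Real.exp_pos _).le
          (by linarith [(hT t (interior_subset ht)).1])
    have hlim : Tendsto (fun t => Real.exp (-(a * t)) * (Real.exp (a * T) * (y T - c))) atTop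
        (𝓝 0) := by
      have := (Real.tendsto_exp_neg_atTop_nhds_zero.comp
        (tendsto_id.const_mul_atTop ha)).mul_const (Real.exp (a * T) * (y T - c))
      simpa using this
    filter_upwards [hlim.eventually_lt_const (sub_pos.mpr hcb), eventually_ge_atTop T]
      with t h1 ht
    have h2 : Real.exp (a * t) * (y t - c) ≤ Real.exp (a * T) * (y T - c) :=
      hanti (Set.self_mem_Ici) ht ht
    have h3 := mul_le_mul_of_nonneg_left h2 (Real.exp_pos (-(a * t))).le
    rw [← mul_assoc, ← Real.exp_add, neg_add_cancel, Real.exp_zero, one_mul] at h3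
    linarith
  refine tendsto_order.mpr ⟨fun b hb => ?_, fun b hb => upper y g L hy hg b hb⟩
  have := upper (fun t => -y t) (fun t => -g t) (-L)
    (fun t ht => by convert! (hy t ht).neg using 1; ring) hg.neg (-b)
    (by rw [neg_div]; exact neg_lt_neg hb)
  filter_upwards [this] with t ht using neg_lt_neg_iff.mp ht

/-- The solution `x` of `(p + r) x₀ + q x₁ = b₀`, `p x₀ + (q + r) x₁ = b₁`. -/
def balanceSol (p q r : ℝ) (b : Fin 2 → ℝ) : Fin 2 → ℝ :=
  ![((p * b 0 + q * b 1) / (p + q + r) + q * ((b 0 - b 1) / r)) / (p + q),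
    ((p * b 0 + q * b 1) / (p + q + r) - p * ((b 0 - b 1) / r)) / (p + q)]

variable {p q r : ℝ}

/-- The difference of the equations gives `r (x₀ - x₁)`, and their combination with weights `p`, `q`
gives `(p + q + r) (p x₀ + q x₁)`; `balanceSol` inverts this decoupling. -/
theorem eq_balanceSol_iff (hp : 0 < p) (hq : 0 < q) (hr : 0 < r) (b x : Fin 2 → ℝ) :
    ((p + r) * x 0 + q * x 1 = b 0 ∧ p * x 0 + (q + r) * x 1 = b 1) ↔ x = balanceSol p q r b := by
  have h1 : p + q ≠ 0 := by positivity
  have h2 : p + q + r ≠ 0 := by positivity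
  constructor
  · rintro ⟨e0, e1⟩
    ext m
    fin_cases m <;> simp only [balanceSol, ← e0, ← e1] <;> simp <;> field_simp <;> ring
  · rintro rfl
    simp only [balanceSol]
    constructor <;> simp <;> field_simp <;> ring

/-- A solution of the relaxation system with convergent forcing tends to the balanced state. -/
theorem tendsto_balanceSol (hp : 0 < p) (hq : 0 < q) (hr : 0 < r) {x b : ℝ → Fin 2 → ℝ}
    {L : Fin 2 → ℝ}
    (h0 : ∀ t, 0 < t →
      HasDerivAt (fun t => x t 0) (b t 0 - ((p + r) * x t 0 + q * x t 1)) t)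
    (h1 : ∀ t, 0 < t →
      HasDerivAt (fun t => x t 1) (b t 1 - (p * x t 0 + (q + r) * x t 1)) t)
    (hb : ∀ m, Tendsto (fun t => b t m) atTop (𝓝 (L m))) (m : Fin 2) :
    Tendsto (fun t => x t m) atTop (𝓝 (balanceSol p q r L m)) := by
  have hpq : p + q ≠ 0 := by positivity
  -- The eigen-combinations `u = x₀ - x₁` and `v = p x₀ + q x₁` solve scalar equations, and `x₀ = (v
  -- + q u) / (p + q)`, `x₁ = (v - p u) / (p + q)`.
  have hu := tendsto_of_hasDerivAt_sub_mul (y := fun t => x t 0 - x t 1)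
    (g := fun t => b t 0 - b t 1) hr
    (fun t ht => by convert! (h0 t ht).sub (h1 t ht) using 1; ring) ((hb 0).sub (hb 1))
  have hv := tendsto_of_hasDerivAt_sub_mul (y := fun t => p * x t 0 + q * x t 1)
    (g := fun t => p * b t 0 + q * b t 1) (a := p + q + r) (by positivity)
    (fun t ht => by
      convert! ((h0 t ht).const_mul p).add ((h1 t ht).const_mul q) using 1; ring)
    (((hb 0).const_mul p).add ((hb 1).const_mul q))
  fin_cases m
  · convert! (hv.add (hu.const_mul q)).div_const (p + q) using 2 with t
    change x t 0 = _
    field_simp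
    ring
  · convert! (hv.sub (hu.const_mul p)).div_const (p + q) using 2 with t
    change x t 1 = _
    field_simp
    ring

/-- Dividing numerator and denominator by `lam` makes the fixed terms `β` and `r` vanish in the
limit. -/
theorem tendsto_weighted_average {h : ℝ → ℝ} {L s : ℝ} (hs : 0 < s) (β r : ℝ)
    (hh : Tendsto h atTop (𝓝 L)) :
    Tendsto (fun lam => (β + lam * s * h lam) / (r + lam * s)) atTop (𝓝 L) := by
  have hlim : Tendsto (fun lam : ℝ => (β / lam + s * h lam) / (r / lam + s)) atTop
      (𝓝 ((0 + s * L) / (0 + s))) :=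
    ((tendsto_const_nhds.div_atTop tendsto_id).add (hh.const_mul s)).div
      ((tendsto_const_nhds.div_atTop tendsto_id).add_const s) (by simpa using hs.ne')
  rw [zero_add, zero_add, mul_div_cancel_left₀ _ hs.ne'] at hlim
  refine hlim.congr' ?_
  filter_upwards [eventually_gt_atTop 0] with lam hl
  rw [← mul_div_mul_left _ _ hl.ne']
  congr 1 <;> field_simp

/-- The balanced state follows the forcing when both the coupling and the forcing are dominated
by a large multiple of the same rate. -/
theorem tendsto_balanceSol_of_coupling (hp : 0 < p) (hq : 0 < q) {s : ℝ} (hs : 0 < s)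
    (r : ℝ) (β : Fin 2 → ℝ) {g : ℝ → Fin 2 → ℝ} {L : Fin 2 → ℝ} (hg : Tendsto g atTop (𝓝 L)) :
    Tendsto (fun lam => balanceSol p q (r + lam * s) (β + (lam * s) • g lam)) atTop (𝓝 L) := by
  have hpq : p + q ≠ 0 := by positivity
  have hg' := tendsto_pi_nhds.mp hg
  have hu : Tendsto (fun lam => ((β + (lam * s) • g lam) 0 - (β + (lam * s) • g lam) 1) /
      (r + lam * s)) atTop (𝓝 (L 0 - L 1)) := by
    refine (tendsto_weighted_average hs (β 0 - β 1) r ((hg' 0).sub (hg' 1))).congr fun lam => ?_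
    simp only [Pi.add_apply, Pi.smul_apply, smul_eq_mul]
    ring
  have hv : Tendsto (fun lam => (p * (β + (lam * s) • g lam) 0 + q * (β + (lam * s) • g lam) 1) /
      (p + q + (r + lam * s))) atTop (𝓝 (p * L 0 + q * L 1)) := by
    refine (tendsto_weighted_average hs (p * β 0 + q * β 1) (p + q + r)
      (((hg' 0).const_mul p).add ((hg' 1).const_mul q))).congr fun lam => ?_
    simp only [Pi.add_apply, Pi.smul_apply, smul_eq_mul]
    ring
  refine tendsto_pi_nhds.mpr fun m => ?_
  fin_cases m
  · convert! (hv.add (hu.const_mul q)).div_const (p + q) using 2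
    change L 0 = _
    field_simp
    ring
  · convert! (hv.sub (hu.const_mul p)).div_const (p + q) using 2
    change L 1 = _
    field_simp
    ring

end Relaxation

/-! ### The steady-state recursion -/

section SteadyState

/-- The forcing of the mode-tagged accuracy by source transitions and by pushes of total rate
`r`. -/
def sourceVector (q₁₂ q₂₁ r : ℝ) : Fin 2 → ℝ :=
  ![q₂₁ * statDist q₁₂ q₂₁ 1 + r * statDist q₁₂ q₂₁ 0,
    q₁₂ * statDist q₁₂ q₂₁ 0 + r * statDist q₁₂ q₂₁ 1]

/-- The steady-state mode-tagged accuracy of the freshest of all but `d` nodes. -/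
def coFresh (n : ℕ) (q₁₂ q₂₁ ls lam : ℝ) : ℕ → Fin 2 → ℝ
  | 0 => fullFreshness q₁₂ q₂₁ ls
  | d + 1 =>
    -- `k` is the size of the set, and `k * (d + 1)` counts the directed links into it from the `d +
    -- 1` nodes outside.
    let k : ℝ := n - (d + 1)
    let s : ℝ := k * (d + 1) / (n - 1)
    balanceSol q₁₂ q₂₁ (k * (ls / n) + lam * s)
      (sourceVector q₁₂ q₂₁ (k * (ls / n)) + (lam * s) • coFresh n q₁₂ q₂₁ ls lam d)

variable {n : ℕ} {q₁₂ q₂₁ ls lam : ℝ}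

theorem fullFreshness_eq_balanceSol (h12 : 0 < q₁₂) (h21 : 0 < q₂₁) (hs : 0 < ls) :
    fullFreshness q₁₂ q₂₁ ls = balanceSol q₁₂ q₂₁ ls (sourceVector q₁₂ q₂₁ ls) := by
  rw [← eq_balanceSol_iff h12 h21 hs]
  simp only [fullFreshness, sourceVector, statDist, Matrix.cons_val_zero, Matrix.cons_val_one]
  have h1 : q₁₂ + q₂₁ ≠ 0 := by positivity
  have h2 : ls + q₁₂ + q₂₁ ≠ 0 := by positivity
  constructor <;> field_simp <;> ring

theorem tendsto_coFresh (h12 : 0 < q₁₂) (h21 : 0 < q₂₁) {d : ℕ} (hd : d < n) :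
    Tendsto (fun lam => coFresh n q₁₂ q₂₁ ls lam d) atTop (𝓝 (fullFreshness q₁₂ q₂₁ ls)) := by
  induction d with
  | zero => exact tendsto_const_nhds
  | succ d ih =>
    -- The set is nonempty, so its incoming gossip rate really grows with `lam`.
    have h1 : (0 : ℝ) < n - (d + 1) := by
      rw [sub_pos]; exact_mod_cast hd
    have h2 : (0 : ℝ) < n - 1 := by
      have : (0 : ℝ) ≤ d := d.cast_nonneg
      linarith
    exact tendsto_balanceSol_of_coupling h12 h21 (by positivity) _ _ (ih (by omega))

/-! ### Convergence of expectations in time -/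

variable (hn : 2 ≤ n) (h12 : 0 < q₁₂) (h21 : 0 < q₂₁) (hs : 0 < ls) (hl : 0 < lam)
  (ν : Measure (State n)) [IsProbabilityMeasure ν]

include hn h12 h21 hs hl

theorem integrable_law {ψ : State n → ℝ} {B : ℝ} (hψ : ∀ z, |ψ z| ≤ B) {t : ℝ} (ht : 0 ≤ t) :
    Integrable ψ (law q₁₂ q₂₁ ls lam ν t) := by
  have := isProbabilityMeasure_law hn h12 h21 hs hl ν ht
  exact Integrable.of_bound (Measurable.of_discrete).aestronglyMeasurable B
    (ae_of_all _ fun z => by simpa using hψ z)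

/-- Since the two mode probabilities sum to one, each solves a scalar relaxation equation of rate
`q₁₂ + q₂₁`. -/
theorem tendsto_integral_inMode (m : Fin 2) :
    Tendsto (fun t => ∫ z, inMode m z ∂(law q₁₂ q₂₁ ls lam ν t)) atTop
      (𝓝 (statDist q₁₂ q₂₁ m)) := by
  have hint : ∀ (m : Fin 2) {t : ℝ}, 0 ≤ t → Integrable (inMode m) (law q₁₂ q₂₁ ls lam ν t) :=
    fun m t ht => integrable_law hn h12 h21 hs hl ν (abs_inMode_le m) ht
  have hone : ∀ t, 0 ≤ t → ∫ z, inMode 0 z ∂(law q₁₂ q₂₁ ls lam ν t) +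
      ∫ z, inMode 1 z ∂(law q₁₂ q₂₁ ls lam ν t) = 1 := by
    intro t ht
    have := isProbabilityMeasure_law hn h12 h21 hs hl ν ht
    rw [← integral_add (hint 0 ht) (hint 1 ht)]
    have : ∀ z : State n, inMode 0 z + inMode 1 z = 1 := by
      intro z
      obtain h | h : z.source = 0 ∨ z.source = 1 := by omega
      all_goals simp [inMode, h]
    simp [this]
  have hq : 0 < q₁₂ + q₂₁ := by positivity
  have key : ∀ m, Tendsto (fun t => ∫ z, inMode m z ∂(law q₁₂ q₂₁ ls lam ν t)) atTop
      (𝓝 (![q₂₁, q₁₂] m / (q₁₂ + q₂₁))) := by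
    intro m
    refine tendsto_of_hasDerivAt_sub_mul (g := fun _ => ![q₂₁, q₁₂] m) hq (fun t ht => ?_)
      tendsto_const_nhds
    convert! hasDerivAt_integral_law hn h12 h21 hs hl ν (abs_inMode_le m) ht using 1
    simp only [generator_inMode]
    have h1 := hone t ht.le
    fin_cases m
    · simp only [Fin.zero_eta, Matrix.cons_val_zero]
      rw [integral_sub ((hint 1 ht.le).const_mul _) ((hint 0 ht.le).const_mul _),
        integral_const_mul, integral_const_mul]
      linear_combination (-q₂₁) * h1
    · simp only [Fin.mk_one, Matrix.cons_val_one, Matrix.cons_val_fin_one]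
      rw [integral_sub ((hint 0 ht.le).const_mul _) ((hint 1 ht.le).const_mul _),
        integral_const_mul, integral_const_mul]
      linear_combination (-q₁₂) * h1
  have := key m
  fin_cases m <;> exact this

theorem hasDerivAt_integral_freshAcc (hν : ∀ᵐ z ∂ν, Consistent z) {A : Finset (Fin n)}
    (hA : A.Nonempty) (m : Fin 2) {t : ℝ} (ht : 0 < t) :
    HasDerivAt (fun t => ∫ z, freshAcc A z * inMode m z ∂(law q₁₂ q₂₁ ls lam ν t))
      (let E : (State n → ℝ) → ℝ := fun ψ => ∫ z, ψ z ∂(law q₁₂ q₂₁ ls lam ν t)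
       let F : Fin 2 → ℝ := fun m => E fun z => freshAcc A z * inMode m z
       ![q₂₁ * (E (inMode 1) - F 1) - q₁₂ * F 0, q₁₂ * (E (inMode 0) - F 0) - q₂₁ * F 1] m +
        A.card * (ls / n) * (E (inMode m) - F m) +
        A.card * (lam / (n - 1)) *
          ∑ i ∈ Aᶜ, ((E fun z => freshAcc (insert i A) z * inMode m z) - F m)) t := by
  convert! hasDerivAt_integral_law hn h12 h21 hs hl ν (abs_freshAcc_mul_inMode_le A m) ht using 1
  rw [integral_congr_ae ((ae_consistent_law hν t).mono
    fun z hz => generator_freshAcc hz hA m)]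
  have hI : ∀ m, Integrable (inMode m) (law q₁₂ q₂₁ ls lam ν t) :=
    fun m => integrable_law hn h12 h21 hs hl ν (abs_inMode_le m) ht.le
  have hF : ∀ (A : Finset (Fin n)) (m : Fin 2),
      Integrable (fun z => freshAcc A z * inMode m z) (law q₁₂ q₂₁ ls lam ν t) :=
    fun A m => integrable_law hn h12 h21 hs hl ν (abs_freshAcc_mul_inMode_le A m) ht.le
  have hD : ∀ i, Integrable (fun z => inMode i z - freshAcc A z * inMode i z)
      (law q₁₂ q₂₁ ls lam ν t) := fun i => (hI i).sub (hF A i)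
  have hG : ∀ i, Integrable (fun z => freshAcc (insert i A) z * inMode m z -
      freshAcc A z * inMode m z) (law q₁₂ q₂₁ ls lam ν t) := fun i => (hF _ m).sub (hF A m)
  have hsum : Integrable (fun z => A.card * (lam / (n - 1)) *
      ∑ i ∈ Aᶜ, (freshAcc (insert i A) z * inMode m z - freshAcc A z * inMode m z))
      (law q₁₂ q₂₁ ls lam ν t) :=
    (integrable_finsetSum _ fun i _ => hG i).const_mul _
  have hpush : Integrable (fun z => A.card * (ls / n) * (inMode m z - freshAcc A z * inMode m z))
      (law q₁₂ q₂₁ ls lam ν t) := (hD m).const_mul _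
  have hmode : ∀ (a b : ℝ) (i j : Fin 2), Integrable (fun z => a * (inMode i z -
      freshAcc A z * inMode i z) - b * (freshAcc A z * inMode j z)) (law q₁₂ q₂₁ ls lam ν t) :=
    fun a b i j => ((hD i).const_mul a).sub ((hF A j).const_mul b)
  have hmodeI : ∀ (a b : ℝ) (i j : Fin 2), ∫ z, (a * (inMode i z -
      freshAcc A z * inMode i z) - b * (freshAcc A z * inMode j z)) ∂(law q₁₂ q₂₁ ls lam ν t) =
      a * (∫ z, inMode i z ∂(law q₁₂ q₂₁ ls lam ν t) -
        ∫ z, freshAcc A z * inMode i z ∂(law q₁₂ q₂₁ ls lam ν t)) -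
        b * ∫ z, freshAcc A z * inMode j z ∂(law q₁₂ q₂₁ ls lam ν t) := fun a b i j => by
    rw [integral_sub ((hD i).const_mul a) ((hF A j).const_mul b),
      integral_const_mul, integral_const_mul, integral_sub (hI i) (hF A i)]
  have hm : Integrable (fun z => ![q₂₁ * (inMode 1 z - freshAcc A z * inMode 1 z) -
        q₁₂ * (freshAcc A z * inMode 0 z), q₁₂ * (inMode 0 z - freshAcc A z * inMode 0 z) -
        q₂₁ * (freshAcc A z * inMode 1 z)] m) (law q₁₂ q₂₁ ls lam ν t) := by
    fin_cases m
    · exact hmode _ _ _ _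
    · exact hmode _ _ _ _
  have hmp := hm.add hpush
  simp only [Pi.add_def] at hmp
  rw [integral_add hmp hsum, integral_add hm hpush, integral_const_mul,
    integral_const_mul, integral_sub (hI m) (hF A m),
    integral_finsetSum _ fun i _ => hG i]
  simp only [integral_sub (hF _ m) (hF A m)]
  congr 2
  fin_cases m
  · exact (hmodeI _ _ _ _).symm
  · exact (hmodeI _ _ _ _).symm

theorem tendsto_integral_freshAcc (hν : ∀ᵐ z ∂ν, Consistent z) (d : ℕ) :
    ∀ A : Finset (Fin n), A.Nonempty → A.card + d = n → ∀ m,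
      Tendsto (fun t => ∫ z, freshAcc A z * inMode m z ∂(law q₁₂ q₂₁ ls lam ν t)) atTop
        (𝓝 (coFresh n q₁₂ q₂₁ ls lam d m)) := by
  have hn0 : (0 : ℝ) < n := by exact_mod_cast (by omega : 0 < n)
  have hn1 : (0 : ℝ) < n - 1 := by rw [sub_pos]; exact_mod_cast (by omega : 1 < n)
  have hI := tendsto_integral_inMode hn h12 h21 hs hl ν
  induction d with
  | zero =>
    intro A hA hcard
    have huniv : Aᶜ = ∅ := by
      rw [← Finset.card_eq_zero, Finset.card_compl, Fintype.card_fin]; omega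
    -- For the whole network the pushes add up to rate `ls` and no sender is left outside, so `lam`
    -- drops out.
    have hc : (A.card : ℝ) * (ls / n) = ls := by
      rw [show A.card = n from hcard]; field_simp
    have hder := fun m t ht => hasDerivAt_integral_freshAcc hn h12 h21 hs hl ν hν hA m (t := t) ht
    simp only [huniv, Finset.sum_empty, mul_zero, add_zero, hc] at hder
    rw [coFresh, fullFreshness_eq_balanceSol h12 h21 hs]
    refine tendsto_balanceSol (b := fun t =>
        ![q₂₁ * (∫ z, inMode 1 z ∂(law q₁₂ q₂₁ ls lam ν t)) +
            ls * (∫ z, inMode 0 z ∂(law q₁₂ q₂₁ ls lam ν t)),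
          q₁₂ * (∫ z, inMode 0 z ∂(law q₁₂ q₂₁ ls lam ν t)) +
            ls * (∫ z, inMode 1 z ∂(law q₁₂ q₂₁ ls lam ν t))])
      (x := fun t m => ∫ z, freshAcc A z * inMode m z ∂(law q₁₂ q₂₁ ls lam ν t)) h12 h21 hs
      (fun t ht => ?_) (fun t ht => ?_) (fun m => ?_)
    · convert! hder 0 t ht using 1
      simp only [Matrix.cons_val_zero]
      ring
    · convert! hder 1 t ht using 1
      simp only [Matrix.cons_val_one, Matrix.cons_val_fin_one]
      ring
    · fin_cases m
      · exact ((hI 1).const_mul _).add ((hI 0).const_mul _)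
      · exact ((hI 0).const_mul _).add ((hI 1).const_mul _)
  | succ d ih =>
    intro A hA hcard
    have hk : (A.card : ℝ) = n - (d + 1) := by
      rw [eq_sub_iff_add_eq]; exact_mod_cast hcard
    have hkpos : (0 : ℝ) < A.card := by exact_mod_cast hA.card_pos
    have hco : Aᶜ.card = d + 1 := by rw [Finset.card_compl, Fintype.card_fin]; omega
    have hder := fun m t ht => hasDerivAt_integral_freshAcc hn h12 h21 hs hl ν hν hA m (t := t) ht
    simp only [Finset.sum_sub_distrib, Finset.sum_const, hco, nsmul_eq_mul] at hder
    -- All `d + 1` enlarged sets have the same size, hence the same limit by induction; this is why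
    -- only the size of `A` matters.
    have hS : ∀ m, Tendsto (fun t => A.card * (lam / (n - 1)) *
        ∑ i ∈ Aᶜ, ∫ z, freshAcc (insert i A) z * inMode m z ∂(law q₁₂ q₂₁ ls lam ν t)) atTop
        (𝓝 (lam * (A.card * (d + 1) / (n - 1)) * coFresh n q₁₂ q₂₁ ls lam d m)) := by
      intro m
      have := (tendsto_finsetSum Aᶜ fun i hi => ih (insert i A) (Finset.insert_nonempty i A)
        (by rw [Finset.card_insert_of_notMem (by simpa using hi)]; omega) m).const_mul
          ((A.card : ℝ) * (lam / (n - 1)))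
      convert! this using 2
      rw [Finset.sum_const, hco, nsmul_eq_mul]
      push_cast
      ring
    simp only [coFresh, ← hk]
    refine tendsto_balanceSol (b := fun t =>
        ![q₂₁ * (∫ z, inMode 1 z ∂(law q₁₂ q₂₁ ls lam ν t)) +
            A.card * (ls / n) * (∫ z, inMode 0 z ∂(law q₁₂ q₂₁ ls lam ν t)) +
            A.card * (lam / (n - 1)) *
              ∑ i ∈ Aᶜ, ∫ z, freshAcc (insert i A) z * inMode 0 z ∂(law q₁₂ q₂₁ ls lam ν t),
          q₁₂ * (∫ z, inMode 0 z ∂(law q₁₂ q₂₁ ls lam ν t)) +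
            A.card * (ls / n) * (∫ z, inMode 1 z ∂(law q₁₂ q₂₁ ls lam ν t)) +
            A.card * (lam / (n - 1)) *
              ∑ i ∈ Aᶜ, ∫ z, freshAcc (insert i A) z * inMode 1 z ∂(law q₁₂ q₂₁ ls lam ν t)])
      (x := fun t m => ∫ z, freshAcc A z * inMode m z ∂(law q₁₂ q₂₁ ls lam ν t)) h12 h21
      (by positivity) (fun t ht => ?_) (fun t ht => ?_) (fun m => ?_)
    · convert! hder 0 t ht using 1
      simp only [Matrix.cons_val_zero]
      push_cast
      ring
    · convert! hder 1 t ht using 1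
      simp only [Matrix.cons_val_one, Matrix.cons_val_fin_one]
      push_cast
      ring
    · fin_cases m
      · exact (((hI 1).const_mul _).add ((hI 0).const_mul _)).add (hS 0)
      · exact (((hI 0).const_mul _).add ((hI 1).const_mul _)).add (hS 1)

/-- The freshest node of a singleton is its only node, so this is an average of singleton limits,
all equal. -/
theorem tendsto_integral_avgAcc (hν : ∀ᵐ z ∂ν, Consistent z) {A : Finset (Fin n)}
    (hA : A.Nonempty) (m : Fin 2) :
    Tendsto (fun t => ∫ z, avgAcc A z * inMode m z ∂(law q₁₂ q₂₁ ls lam ν t)) atTop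
      (𝓝 (coFresh n q₁₂ q₂₁ ls lam (n - 1) m)) := by
  have hc : (A.card : ℝ) ≠ 0 := by exact_mod_cast hA.card_pos.ne'
  have hlim := (tendsto_finsetSum A fun l _ => tendsto_integral_freshAcc hn h12 h21 hs hl ν hν
    (n - 1) {l} (Finset.singleton_nonempty l) (by simp; omega) m).div_const (A.card : ℝ)
  rw [Finset.sum_const, nsmul_eq_mul, mul_div_cancel_left₀ _ hc] at hlim
  refine hlim.congr' ?_
  filter_upwards [eventually_ge_atTop 0] with t ht
  rw [← integral_finsetSum _ fun l _ =>
    integrable_law hn h12 h21 hs hl ν (abs_freshAcc_mul_inMode_le {l} m) ht, ← integral_div]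
  refine integral_congr_ae (ae_of_all _ fun z => ?_)
  simp only [avgAcc, freshAcc_singleton, ← Finset.sum_mul]
  ring

theorem integral_eq_sum_inMode {ψ : State n → ℝ} (hψ : ∀ z, |ψ z| ≤ 1) {t : ℝ} (ht : 0 ≤ t) :
    ∫ z, ψ z ∂(law q₁₂ q₂₁ ls lam ν t) =
      ∑ m, ∫ z, ψ z * inMode m z ∂(law q₁₂ q₂₁ ls lam ν t) := by
  rw [← integral_finsetSum _ fun m _ => integrable_law hn h12 h21 hs hl ν (B := 1) (fun z => by
    rw [abs_mul]
    exact mul_le_one₀ (hψ z) (abs_nonneg _) (abs_inMode_le m z)) ht]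
  refine integral_congr_ae (ae_of_all _ fun z => ?_)
  simp [inMode]

end SteadyState

/-! ### The linear system for the average accuracy and the conclusion -/

theorem abs_avgAcc_le {n : ℕ} (A : Finset (Fin n)) (z : State n) : |avgAcc A z| ≤ 1 := by
  rw [avgAcc, abs_div, Nat.abs_cast]
  refine div_le_one_of_le₀ ((Finset.abs_sum_le_sum_abs _ _).trans ?_) (Nat.cast_nonneg _)
  exact (Finset.sum_le_card_nsmul A _ 1 fun l _ => abs_acc_le z l).trans (by simp)

/-- This is the recursion step for sets of size `k = 1`: there the coupling `k (n - k) / (n - 1)`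
equals one, so gossip enters with rate exactly `lam`. -/
theorem accMatrix_mulVec_eq_iff {n : ℕ} {q₁₂ q₂₁ ls lam : ℝ} (hn : 2 ≤ n) (h12 : 0 < q₁₂)
    (h21 : 0 < q₂₁) (hs : 0 < ls) (hl : 0 < lam) (x : Fin 2 → ℝ) :
    (accMatrix n q₁₂ q₂₁ ls lam).mulVec x =
      accVector n q₁₂ q₂₁ ls + lam • coFresh n q₁₂ q₂₁ ls lam (n - 2) ↔
      x = coFresh n q₁₂ q₂₁ ls lam (n - 1) := by
  obtain ⟨d, rfl⟩ : ∃ d, n = d + 2 := ⟨n - 2, by omega⟩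
  have hk : ((d + 2 : ℕ) : ℝ) - (d + 1) = 1 := by push_cast; ring
  have hd : ((d : ℝ) + 1) / (((d + 2 : ℕ) : ℝ) - 1) = 1 := by
    push_cast
    rw [show (d : ℝ) + 2 - 1 = d + 1 by ring]
    exact div_self (by positivity)
  simp only [Nat.add_sub_cancel, show d + 2 - 1 = d + 1 by omega, coFresh, hk, one_mul, hd, mul_one]
  rw [← eq_balanceSol_iff h12 h21 (by positivity), funext_iff, Fin.forall_fin_two]
  simp [accMatrix, accVector, sourceVector, Matrix.mulVec, dotProduct, add_assoc]

end Gossip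

end

theorem mainTheorem6 (n : ℕ) (hn : 2 ≤ n) (q₁₂ q₂₁ ls : ℝ)
    (hq₁₂ : 0 < q₁₂) (hq₂₁ : 0 < q₂₁) (hls : 0 < ls) :
    ∃ (f : ℝ → ℕ → Fin 2 → ℝ) (c : ℝ → Fin 2 → ℝ),
      -- `f lam k` and `c lam` are the steady-state mode-tagged accuracies of every set of `k` nodes
      (∀ lam : ℝ, 0 < lam →
        ∀ (ν : Measure (Gossip.State n)) [IsProbabilityMeasure ν],
          (∀ᵐ z ∂ν, Gossip.Consistent z) →
          ∀ A : Finset (Fin n), A.Nonempty →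
            (∀ m : Fin 2,
              Tendsto (fun t : ℝ => ∫ z, Gossip.freshAcc A z * Gossip.inMode m z
                  ∂(Gossip.law q₁₂ q₂₁ ls lam ν t)) atTop (𝓝 (f lam A.card m)) ∧
              Tendsto (fun t : ℝ => ∫ z, Gossip.avgAcc A z * Gossip.inMode m z
                  ∂(Gossip.law q₁₂ q₂₁ ls lam ν t)) atTop (𝓝 (c lam m))) ∧
            Tendsto (fun t : ℝ => ∫ z, Gossip.freshAcc A z
                ∂(Gossip.law q₁₂ q₂₁ ls lam ν t)) atTop (𝓝 (∑ m, f lam A.card m)) ∧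
            Tendsto (fun t : ℝ => ∫ z, Gossip.avgAcc A z
                ∂(Gossip.law q₁₂ q₂₁ ls lam ν t)) atTop (𝓝 (∑ m, c lam m))) ∧
      -- `c lam` is the unique solution of the linear system
      (∀ lam : ℝ, 0 < lam → ∀ x : Fin 2 → ℝ,
        (Gossip.accMatrix n q₁₂ q₂₁ ls lam).mulVec x =
            Gossip.accVector n q₁₂ q₂₁ ls + lam • f lam 2 ↔ x = c lam) ∧
      -- `f_n` does not depend on `lam`
      (∀ lam : ℝ, 0 < lam → f lam n = Gossip.fullFreshness q₁₂ q₂₁ ls) ∧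
      -- the limits as the gossip rate tends to infinity
      Tendsto c atTop (𝓝 (Gossip.fullFreshness q₁₂ q₂₁ ls)) ∧
      Tendsto (fun lam => f lam 2) atTop (𝓝 (Gossip.fullFreshness q₁₂ q₂₁ ls)) ∧
      Tendsto (fun lam => ∑ m, c lam m) atTop
        (𝓝 (∑ m, Gossip.fullFreshness q₁₂ q₂₁ ls m)) := by
  have hc : Tendsto (fun lam => Gossip.coFresh n q₁₂ q₂₁ ls lam (n - 1)) atTop
      (𝓝 (Gossip.fullFreshness q₁₂ q₂₁ ls)) := Gossip.tendsto_coFresh hq₁₂ hq₂₁ (by omega)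
  -- `coFresh` is indexed by the number of missing nodes, so size `k` becomes `n - k`, and `c` is
  -- the value for singletons.
  refine ⟨fun lam k => Gossip.coFresh n q₁₂ q₂₁ ls lam (n - k),
    fun lam => Gossip.coFresh n q₁₂ q₂₁ ls lam (n - 1), ?_, ?_, ?_, hc,
    Gossip.tendsto_coFresh hq₁₂ hq₂₁ (by omega),
    tendsto_finsetSum _ fun m _ => tendsto_pi_nhds.mp hc m⟩
  · intro lam hl ν _ hν A hA
    have hcard : A.card ≤ n := by simpa using A.card_le_univ
    have hF := Gossip.tendsto_integral_freshAcc hn hq₁₂ hq₂₁ hls hl ν hν (n - A.card) A hA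
      (by omega)
    have hC := Gossip.tendsto_integral_avgAcc hn hq₁₂ hq₂₁ hls hl ν hν hA
    refine ⟨fun m => ⟨hF m, hC m⟩, ?_, ?_⟩
    · refine (tendsto_finsetSum Finset.univ fun m _ => hF m).congr' ?_
      filter_upwards [eventually_ge_atTop 0] with t ht
      exact (Gossip.integral_eq_sum_inMode hn hq₁₂ hq₂₁ hls hl ν (Gossip.abs_freshAcc_le A) ht).symm
    · refine (tendsto_finsetSum Finset.univ fun m _ => hC m).congr' ?_
      filter_upwards [eventually_ge_atTop 0] with t ht
      exact (Gossip.integral_eq_sum_inMode hn hq₁₂ hq₂₁ hls hl ν (Gossip.abs_avgAcc_le A) ht).symm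
  · exact fun lam hl x => Gossip.accMatrix_mulVec_eq_iff hn hq₁₂ hq₂₁ hls hl x
  · intro lam _
    simp [Gossip.coFresh]
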